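/- Let $d\ge 1$, let $|\cdot|$ be any norm on $\mathbb R^d$, let $B(x,\rho)$ denote its closed balls and let $\lambda_d$ be Lebesgue measure. For a nonempty finite set $\alpha\subset\mathbb R^d$ write $d(x,\alpha)=\min_{a\in\alpha}|x-a|$. Let $\widehat X^{\alpha}=\sum_{a\in\alpha}a\,\mathbf 1_{\{X\in C_a(\alpha)\}}$ be a Voronoi quantization of a random vector $X$, that is, $(C_a(\alpha))_{a\in\alpha}$ is any Borel partition of $\mathbb R^d$ with $C_a(\alpha)\subset\{x:|x-a|=d(x,\alpha)\}$; and write $\|Y\|_s^s=\mathbb E|Y|^s$. Let $0<r<s<\infty$, and let $X$ be an $\mathbb R^d$-valued random variable with distribution $P=f\cdot\lambda_d$, where $f:\mathbb R^d\to[0,\infty)$ is Borel, such that $\mathbb E|X|^{r+\eta}<\infty$ for some $\eta>0$. Let $b\in(0,1/2)$. Then there is a real constant $C(b)>0$, depending only on $b$, $r$, $s$, $d$, the norm and the distribution $P$ (in particular neither on $\theta$, $\mu$, nor on the quantizers $\alpha_n$, nor on $n$), such that the following holds. Let $\theta>0$ and $\mu\in\mathbb R^d$ be such that the distribution $P_{\theta,\mu}$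 of $\frac{X-\mu}{\theta}+\mu$ is absolutely continuous with respect to $P$. Let $(\alpha_n)_{n\ge1}$ be an $L^r(P)$-optimal sequence of quantizers, i.e. for every $n\ge1$, $\alpha_n$ is a nonempty set of at most $n$ points and $$\int d(x,\alpha_n)^r\,dP(x)=\inf\Big\{\int d(x,\alpha)^r\,dP(x):\ \emptyset\ne\alpha\subset\mathbb R^d,\ \operatorname{card}\alpha\le n\Big\}.$$ Suppose that the maximal function $$\psi_b(x)=\sup_{n\ge1}\frac{\lambda_d\big(B(x,b\,d(x,\alpha_n))\big)}{P\big(B(x,b\,d(x,\alpha_n))\big)}\in[0,\infty]$$ satisfies $\psi_b^{s/(d+r)}\in L^1(P_{\theta,\mu})$. Put $\alpha_n^{\theta,\mu}=\{\mu+\theta(a-\mu):a\in\alpha_n\}$ and $f_{\theta,\mu}(x)=f(\mu+\theta(x-\mu))$. Then, with the convention $0\cdot\infty=0$ in the integrand, $$\limsup_{n\to\infty} n^{s/d}\,\big\|X-\widehat X^{\alpha_n^{\theta,\mu}}\big\|_s^s\ \le\ \theta^{s+d}\,C(b)\int_{\mathbb R^d} f_{\theta,\mu}\,f^{-\frac{s}{d+r}}\,d\lambda_d\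 <\ +\infty .$$ -/

import Mathlib

open MeasureTheory ProbabilityTheory Filter
open scoped ENNReal NNReal

namespace Quantization

noncomputable section

variable {E : Type*} [NormedAddCommGroup E] [NormedSpace ℝ E] [MeasurableSpace E]

/-- `∫ d(x, α)^r dP(x)`, where `d(x, α) = min_{a ∈ α} |x - a|` (used for nonempty `α` only). -/
def distortion (P : Measure E) (r : ℝ) (α : Finset E) : ℝ≥0∞ :=
  ∫⁻ x, ENNReal.ofReal (Metric.infDist x (α : Set E)) ^ r ∂P

/-- The `n`-th `L^r`-quantization error `e_{n,r}(P)`: the infimum of `(∫ d(x, α)^r dP(x))^{1/r}`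
over the nonempty codebooks `α` with at most `n` points. -/
def quantizationError (P : Measure E) (r : ℝ) (n : ℕ) : ℝ≥0∞ :=
  ⨅ (α : Finset E) (_ : α.Nonempty) (_ : α.card ≤ n), distortion P r α ^ (1 / r)

/-- `(α_n)_{n ≥ 1}` is an (exactly) `L^r(P)`-optimal sequence of quantizers. The value `α 0` is
irrelevant. -/
def IsOptimalSequence (P : Measure E) (r : ℝ) (α : ℕ → Finset E) : Prop :=
  ∀ n : ℕ, 1 ≤ n → (α n).Nonempty ∧ (α n).card ≤ n ∧
    quantizationError P r n ^ r = distortion P r (α n)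

/-- The maximal function `ψ_b(x) = sup_{n ≥ 1} vol(B(x, b d(x, α_n))) / P(B(x, b d(x, α_n)))`,
with values in `[0, ∞]`; a quotient `c / 0` with `c > 0` is `∞`, and `0 / 0` (which occurs only
at the points `x` of the codebooks, when `P` is absolutely continuous) is `0`. -/
def maximalFunction (vol P : Measure E) (α : ℕ → Finset E) (b : ℝ) (x : E) : ℝ≥0∞ :=
  ⨆ (n : ℕ) (_ : 1 ≤ n),
    vol (Metric.closedBall x (b * Metric.infDist x (α n : Set E))) /
      P (Metric.closedBall x (b * Metric.infDist x (α n : Set E)))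

open Classical in
/-- The codebook `α^{θ,μ} = {μ + θ (a - μ) : a ∈ α}`. -/
def dilate (θ : ℝ) (μ : E) (α : Finset E) : Finset E :=
  α.image fun a => μ + θ • (a - μ)

/-- `P_{θ,μ}`, the image of `P` under `x ↦ (x - μ) / θ + μ`. -/
def dilatedLaw (θ : ℝ) (μ : E) (P : Measure E) : Measure E :=
  P.map fun x => θ⁻¹ • (x - μ) + μ

/-- `(C_a)_{a ∈ α}` is a Voronoi partition of the space with respect to the codebook `α`. -/
structure IsVoronoiPartition (α : Finset E) (C : E → Set E) : Prop where
  measurableSet : ∀ a ∈ α, MeasurableSet (C a)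
  disjoint : ∀ a ∈ α, ∀ a' ∈ α, a ≠ a' → Disjoint (C a) (C a')
  covers : ∀ x, ∃ a ∈ α, x ∈ C a
  nearest : ∀ a ∈ α, ∀ x ∈ C a, ∀ a' ∈ α, ‖x - a‖ ≤ ‖x - a'‖

/-- The quantization `X̂ = ∑_{a ∈ α} a 1_{X ∈ C_a}` of `X` associated with the cells `C_a`. -/
def voronoiQuantization {Ω : Type*} (α : Finset E) (C : E → Set E) (X : Ω → E) (ω : Ω) : E :=
  ∑ a ∈ α, (X ⁻¹' C a).indicator (fun _ => a) ω

end

end Quantization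

/-!
Let `e_n` be the minimal `r`-th power distortion and `w = (1 + ‖x‖)^σ` with `σ = (r + η) / r`, so
that `w^r` is `P`-integrable. A maximal set of points at mutual distance about `n^{-1/d} w` has at
most `n` elements, since balls whose radii are proportional to `w` have bounded total size; this is
Pierce's bound `e_n = O(n^{-r/d})`. In a nearly optimal codebook of `n + 1` points some point has at
once a cell with distortion and weighted mass `O(1/n)` of the total and a neighbour at distance
`O(n^{-1/d} w)`, so deleting it costs little: `e_n - e_{n+1} = O(n^{-(1 + r/d)})`.

Conversely, adding `x` to the optimal codebook `α_n` gains at least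
`((1 - b)^r - b^r) ρ^r P(B(x, bρ))`, where `ρ = d(x, α_n)`, because the points of `B(x, bρ)` were
at distance at least `(1 - b) ρ` from `α_n` and are now within `b ρ` of `x`. Comparing the two
estimates bounds `(n^{1/d} d(x, α_n))^{d + r}` by a constant times the ball ratio
`vol(B(x, bρ)) / P(B(x, bρ))`. This ratio tends to `1 / f(x)` by Lebesgue differentiation and is
dominated by `ψ_b`, so the reverse Fatou lemma under the dilated law and a change of variables
conclude.
-/

open Metric
open scoped Topology

namespace Quantization

section Weight

variable {E : Type*} [NormedAddCommGroup E]

/-- The weight `(1 + ‖x‖)^σ`. For `σ > 1` it is the local scale of the codebooks in Pierce's bound,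
coarser far from the origin, and its `r`-th moment under `P` is the moment of order `σ r`. -/
noncomputable def weight (σ : ℝ) (x : E) : ℝ := (1 + ‖x‖) ^ σ

theorem weight_pos (σ : ℝ) (x : E) : 0 < weight σ x := by
  unfold weight
  positivity

theorem weight_le_of_norm_sub_le {σ L : ℝ} (hσ : 0 ≤ σ) {x y : E}
    (h : ‖x - y‖ ≤ L * (1 + ‖y‖)) : weight σ x ≤ (1 + L) ^ σ * weight σ y := by
  have hL : 0 ≤ L := nonneg_of_mul_nonneg_left ((norm_nonneg _).trans h) (by positivity)
  unfold weight
  rw [← Real.mul_rpow (by positivity) (by positivity)]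
  gcongr
  linarith [norm_le_norm_add_norm_sub' x y]

theorem lintegral_weight_rpow_lt_top [MeasurableSpace E] (P : Measure E) [IsFiniteMeasure P]
    {q r : ℝ} (hq : 0 ≤ q) (hr : r ≠ 0) (h : ∫⁻ x, ‖x‖ₑ ^ q ∂P < ∞) :
    ∫⁻ x, ENNReal.ofReal (weight (q / r) x) ^ r ∂P < ∞ := by
  calc ∫⁻ x, ENNReal.ofReal (weight (q / r) x) ^ r ∂P
      ≤ ∫⁻ x, 2 ^ q * (1 + ‖x‖ₑ ^ q) ∂P := by
        refine lintegral_mono fun x => ?_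
        rw [weight, ← ENNReal.ofReal_rpow_of_pos (by positivity), ← ENNReal.rpow_mul,
          div_mul_cancel₀ _ hr, ENNReal.ofReal_add zero_le_one (norm_nonneg _),
          ENNReal.ofReal_one, ofReal_norm]
        simpa using ENNReal.add_rpow_le_two_rpow_mul_rpow_add_rpow 1 ‖x‖ₑ hq
    _ = 2 ^ q * (P Set.univ + ∫⁻ x, ‖x‖ₑ ^ q ∂P) := by
        rw [lintegral_const_mul' _ _ (by finiteness), lintegral_add_left measurable_const]
        simp
    _ < ∞ := ENNReal.mul_lt_top (by finiteness) (ENNReal.add_lt_top.2 ⟨by finiteness, h⟩)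

end Weight

section Packing

variable {E : Type*} [NormedAddCommGroup E] [NormedSpace ℝ E] [FiniteDimensional ℝ E]
  [Nontrivial E]

theorem lintegral_inv_weight_pow_lt_top [MeasurableSpace E] [BorelSpace E] (vol : Measure E)
    [vol.IsAddHaarMeasure] {σ : ℝ} (hσ : 1 < σ) :
    ∫⁻ x : E, ENNReal.ofReal ((weight σ x ^ Module.finrank ℝ E)⁻¹) ∂vol < ∞ := by
  have hd : (0 : ℝ) < Module.finrank ℝ E := mod_cast Module.finrank_pos
  have heq (x : E) : (weight σ x ^ Module.finrank ℝ E)⁻¹ =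
      (1 + ‖x‖) ^ (-(σ * Module.finrank ℝ E)) := by
    rw [Real.rpow_neg (by positivity), Real.rpow_mul (by positivity), Real.rpow_natCast, weight]
  simpa only [heq] using finite_integral_one_add_norm (μ := vol) (lt_mul_of_one_lt_left hd hσ)

theorem ofReal_div_weight_pow_mul_le_setLIntegral [MeasurableSpace E] [BorelSpace E]
    (vol : Measure E) [vol.IsAddHaarMeasure] {σ L ρ : ℝ} (hσ : 0 ≤ σ) {a : E} (hρ : 0 ≤ ρ)
    (hL : ρ ≤ L * (1 + ‖a‖)) :
    ENNReal.ofReal ((ρ / weight σ a) ^ Module.finrank ℝ E) * vol (ball 0 1) ≤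
      ∫⁻ x in ball a ρ, ENNReal.ofReal (((1 + L) ^ σ) ^ Module.finrank ℝ E) *
        ENNReal.ofReal ((weight σ x ^ Module.finrank ℝ E)⁻¹) ∂vol := by
  have hL' : 0 ≤ L := nonneg_of_mul_nonneg_left (hρ.trans hL) (by positivity)
  have ha := weight_pos σ a
  calc ENNReal.ofReal ((ρ / weight σ a) ^ Module.finrank ℝ E) * vol (ball 0 1)
      = ∫⁻ _ in ball a ρ, ENNReal.ofReal ((weight σ a ^ Module.finrank ℝ E)⁻¹) ∂vol := by
        rw [setLIntegral_const, Measure.addHaar_ball vol a hρ, ← mul_assoc,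
          ← ENNReal.ofReal_mul (by positivity), div_pow, div_eq_inv_mul]
    _ ≤ _ := by
        refine setLIntegral_mono' measurableSet_ball fun x hx => ?_
        have hxa : ‖x - a‖ ≤ L * (1 + ‖a‖) := (mem_ball_iff_norm.1 hx).le.trans hL
        have hx0 := weight_pos σ x
        rw [← ENNReal.ofReal_mul (by positivity)]
        refine ENNReal.ofReal_le_ofReal ?_
        rw [inv_le_iff_one_le_mul₀ (by positivity), mul_right_comm, ← mul_pow,
          ← div_eq_mul_inv, one_le_div₀ (by positivity)]
        gcongr
        exact weight_le_of_norm_sub_le hσ hxa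

/-- Each summand is, up to a constant factor, the integral of `weight^{-d}` over its ball, and
`weight^{-d}` is integrable because `σ > 1`. -/
theorem exists_sum_div_weight_pow_le {σ : ℝ} (hσ : 1 < σ) (L : ℝ) :
    ∃ M : ℝ, 0 < M ∧ ∀ (α : Finset E) (ρ : E → ℝ), (∀ a ∈ α, 0 ≤ ρ a) →
      (∀ a ∈ α, ρ a ≤ L * (1 + ‖a‖)) →
      (α : Set E).PairwiseDisjoint (fun a => ball a (ρ a)) →
      ∑ a ∈ α, (ρ a / weight σ a) ^ Module.finrank ℝ E ≤ M := by
  let : MeasurableSpace E := borel E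
  have : BorelSpace E := ⟨rfl⟩
  let vol : Measure E := Measure.addHaar
  set d := Module.finrank ℝ E
  have hv0 : vol (ball 0 1) ≠ 0 := (measure_ball_pos vol 0 one_pos).ne'
  set T := ENNReal.ofReal (((1 + L) ^ σ) ^ d) *
    ∫⁻ x, ENNReal.ofReal ((weight σ x ^ d)⁻¹) ∂vol with hT
  have hT' : T / vol (ball 0 1) ≠ ∞ :=
    ENNReal.div_ne_top
      (ENNReal.mul_ne_top ENNReal.ofReal_ne_top (lintegral_inv_weight_pow_lt_top vol hσ).ne) hv0
  refine ⟨(T / vol (ball 0 1)).toReal + 1, by positivity, fun α ρ hρ hL hdisj => ?_⟩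
  have hsum : ENNReal.ofReal (∑ a ∈ α, (ρ a / weight σ a) ^ d) * vol (ball 0 1) ≤ T := by
    rw [ENNReal.ofReal_sum_of_nonneg fun a ha =>
      pow_nonneg (div_nonneg (hρ a ha) (weight_pos σ a).le) d, Finset.sum_mul, hT,
      ← lintegral_const_mul' _ _ ENNReal.ofReal_ne_top]
    refine (Finset.sum_le_sum fun a ha => ofReal_div_weight_pow_mul_le_setLIntegral vol
      (by positivity) (hρ a ha) (hL a ha)).trans ?_
    rw [← lintegral_biUnion_finset hdisj fun _ _ => measurableSet_ball]
    exact setLIntegral_le_lintegral _ _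
  have hle := (ENNReal.le_div_iff_mul_le (.inl hv0) (.inl measure_ball_lt_top.ne)).2 hsum
  linarith [(ENNReal.ofReal_le_iff_le_toReal hT').1 hle]

theorem exists_sum_infDist_erase_div_weight_pow_le [DecidableEq E] {σ : ℝ}
    (hσ : 1 < σ) (R : ℝ) :
    ∃ M : ℝ, ∀ α : Finset E, (∀ a, ∃ a' ∈ α, a' ≠ a ∧ ‖a'‖ ≤ R) →
      ∑ a ∈ α, (infDist a (α.erase a : Set E) / weight σ a) ^ Module.finrank ℝ E ≤ M := by
  obtain ⟨M, -, hpack⟩ := exists_sum_div_weight_pow_le (E := E) hσ (1 + R)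
  refine ⟨2 ^ Module.finrank ℝ E * M, fun α hR => ?_⟩
  have hle {a a' : E} (ha' : a' ∈ α) (hne : a' ≠ a) :
      infDist a (α.erase a : Set E) ≤ dist a a' :=
    infDist_le_dist_of_mem (Finset.mem_coe.2 (Finset.mem_erase.2 ⟨hne, ha'⟩))
  have hsum := hpack α (fun a => infDist a (α.erase a : Set E) / 2)
    (fun a _ => div_nonneg infDist_nonneg zero_le_two)
    (fun a _ => ?_) (fun a ha a' ha' hne => ball_disjoint_ball ?_)
  · calc ∑ a ∈ α, (infDist a (α.erase a : Set E) / weight σ a) ^ Module.finrank ℝ E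
        = 2 ^ Module.finrank ℝ E * ∑ a ∈ α,
            (infDist a (α.erase a : Set E) / 2 / weight σ a) ^ Module.finrank ℝ E := by
          rw [Finset.mul_sum]
          refine Finset.sum_congr rfl fun a _ => ?_
          rw [← mul_pow]
          ring
      _ ≤ _ := by gcongr
  · obtain ⟨a', ha', hne, ha'R⟩ := hR a
    have hδ := hle ha' hne
    rw [dist_eq_norm] at hδ
    nlinarith [norm_sub_le a a', norm_nonneg a, norm_nonneg a',
      infDist_nonneg (x := a) (s := (α.erase a : Set E))]
  · linarith [hle ha' hne.symm, hle ha hne, dist_comm a a']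

end Packing

section Covering

variable {E : Type*} [NormedAddCommGroup E] {σ t : ℝ} {α : Finset E}

/-- A finite set whose points lie at mutual distance at least `t` times the mean of their weights.
Maximal such sets are the codebooks in Pierce's bound. Only points whose local scale `t * weight`
is at most `1 + ‖a‖` are allowed; the others are well approximated by the origin. -/
structure IsWeightSeparated (σ t : ℝ) (α : Finset E) : Prop where
  mul_weight_le : ∀ a ∈ α, t * weight σ a ≤ 1 + ‖a‖
  pairwise : (α : Set E).Pairwise fun a a' => t * (weight σ a + weight σ a') / 2 ≤ ‖a - a'‖

theorem IsWeightSeparated.insert [DecidableEq E] (hα : IsWeightSeparated σ t α) {x : E}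
    (hx : t * weight σ x ≤ 1 + ‖x‖)
    (h : ∀ a ∈ α, t * (weight σ x + weight σ a) / 2 ≤ ‖x - a‖) :
    IsWeightSeparated σ t (insert x α) where
  mul_weight_le := Finset.forall_mem_insert .. |>.2 ⟨hx, hα.mul_weight_le⟩
  pairwise := by
    have hsymm : Std.Symm fun a a' : E => t * (weight σ a + weight σ a') / 2 ≤ ‖a - a'‖ :=
      ⟨fun a a' h => by rwa [norm_sub_rev, add_comm]⟩
    rw [Finset.coe_insert]
    exact Set.pairwise_insert_of_symm.2 ⟨hα.pairwise, fun a ha _ => h a ha⟩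

theorem IsWeightSeparated.infDist_le_of_exists_norm_sub_le (hα : IsWeightSeparated σ t α)
    (hσ : 0 ≤ σ) (ht : 0 ≤ t) {x : E} (hx : t * weight σ x ≤ 1 + ‖x‖)
    (h : ∃ a ∈ α, ‖x - a‖ ≤ t * (weight σ x + weight σ a) / 2) :
    infDist x (α : Set E) ≤ 3 ^ σ * (t * weight σ x) := by
  obtain ⟨a, ha, hxa⟩ := h
  have hax : ‖a - x‖ ≤ 2 * (1 + ‖x‖) := by
    rw [norm_sub_rev] at hxa
    linarith [hα.mul_weight_le a ha, norm_le_norm_add_norm_sub' a x]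
  have hwa : weight σ a ≤ 3 ^ σ * weight σ x := by
    convert weight_le_of_norm_sub_le hσ hax using 3
    norm_num
  have hwx : weight σ x ≤ 3 ^ σ * weight σ x :=
    le_mul_of_one_le_left (weight_pos σ x).le (Real.one_le_rpow (by norm_num) hσ)
  calc infDist x (α : Set E) ≤ ‖x - a‖ := by
        simpa [dist_eq_norm] using infDist_le_dist_of_mem (x := x) (Finset.mem_coe.2 ha)
    _ ≤ t * (weight σ x + weight σ a) / 2 := hxa
    _ ≤ t * (3 ^ σ * weight σ x + 3 ^ σ * weight σ x) / 2 := by gcongr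
    _ = 3 ^ σ * (t * weight σ x) := by ring

theorem infDist_le_of_one_add_norm_lt (hσ : 0 ≤ σ) (h0 : (0 : E) ∈ α) {x : E}
    (hx : 1 + ‖x‖ < t * weight σ x) : infDist x (α : Set E) ≤ 3 ^ σ * (t * weight σ x) :=
  calc infDist x (α : Set E) ≤ ‖x‖ := by
        simpa using infDist_le_dist_of_mem (x := x) (Finset.mem_coe.2 h0)
    _ ≤ t * weight σ x := by linarith
    _ ≤ 3 ^ σ * (t * weight σ x) :=
        le_mul_of_one_le_left (by linarith [norm_nonneg x]) (Real.one_le_rpow (by norm_num) hσ)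

theorem exists_infDist_le_of_isWeightSeparated_card_lt (hσ : 0 ≤ σ) (ht : 0 < t) {n : ℕ}
    (hcard : ∀ α : Finset E, IsWeightSeparated σ t α → α.card < n) :
    ∃ α : Finset E, α.Nonempty ∧ α.card ≤ n ∧
      ∀ x, infDist x (α : Set E) ≤ 3 ^ σ * (t * weight σ x) := by
  classical
  obtain ⟨α, hα, hmax⟩ := Set.Finite.exists_maximalFor' Finset.card {α | IsWeightSeparated σ t α}
    ((Set.finite_lt_nat n).subset (Set.image_subset_iff.2 hcard))
    ⟨(∅ : Finset E), by simp, by simp⟩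
  refine ⟨insert 0 α, Finset.insert_nonempty 0 α,
    (Finset.card_insert_le 0 α).trans (hcard α hα), fun x => ?_⟩
  rcases lt_or_ge (1 + ‖x‖) (t * weight σ x) with hx | hx
  · exact infDist_le_of_one_add_norm_lt hσ (Finset.mem_insert_self 0 α) hx
  have hnear : ∃ a ∈ α, ‖x - a‖ ≤ t * (weight σ x + weight σ a) / 2 := by
    by_contra! hfar
    have hxα : x ∉ α := fun hxα => by
      have hlt := hfar x hxα
      rw [sub_self, norm_zero] at hlt
      have := mul_pos ht (weight_pos σ x)
      linarith
    have hle := hmax (hα.insert hx fun a ha => (hfar a ha).le)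
      (Finset.card_le_card (Finset.subset_insert x α))
    rw [Finset.card_insert_of_notMem hxα] at hle
    exact absurd hle (by simp)
  have hαne : (α : Set E).Nonempty := hnear.imp fun a ha => ha.1
  exact (infDist_le_infDist_of_subset (by simp) hαne).trans
    (hα.infDist_le_of_exists_norm_sub_le hσ ht.le hx hnear)

end Covering

section Pierce

variable {E : Type*} [NormedAddCommGroup E] [NormedSpace ℝ E] [FiniteDimensional ℝ E]
  [Nontrivial E]

theorem exists_card_mul_pow_le_of_isWeightSeparated {σ : ℝ} (hσ : 1 < σ) :
    ∃ M : ℝ, 0 < M ∧ ∀ t : ℝ, 0 < t → ∀ α : Finset E, IsWeightSeparated σ t α →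
      α.card * (t / 2) ^ Module.finrank ℝ E ≤ M := by
  obtain ⟨M, hM, h⟩ := exists_sum_div_weight_pow_le (E := E) hσ 1
  refine ⟨M, hM, fun t ht α hα => ?_⟩
  have hsum := h α (fun a => t * weight σ a / 2)
    (fun a _ => by have := weight_pos σ a; positivity)
    (fun a ha => by linarith [hα.mul_weight_le a ha, mul_pos ht (weight_pos σ a)])
    (fun a ha a' ha' hne => ball_disjoint_ball (by
      rw [dist_eq_norm]
      linarith [hα.pairwise ha ha' hne]))
  have hterm (a : E) : t * weight σ a / 2 / weight σ a = t / 2 := by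
    have := (weight_pos σ a).ne'
    field_simp
  simpa only [hterm, Finset.sum_const, nsmul_eq_mul] using hsum

theorem exists_infDist_le_weight {σ : ℝ} (hσ : 1 < σ) :
    ∃ M : ℝ, 0 < M ∧ ∀ n : ℕ, 1 ≤ n → ∃ α : Finset E, α.Nonempty ∧ α.card ≤ n ∧
      ∀ x, infDist x (α : Set E) ≤
        M * (n : ℝ) ^ (-(1 / (Module.finrank ℝ E : ℝ))) * weight σ x := by
  obtain ⟨M, hM, hcard⟩ := exists_card_mul_pow_le_of_isWeightSeparated (E := E) hσ
  have hd : 0 < Module.finrank ℝ E := Module.finrank_pos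
  set d := Module.finrank ℝ E
  refine ⟨3 ^ σ * (2 * (2 * M) ^ (1 / (d : ℝ))), by positivity, fun n hn => ?_⟩
  have hn0 : (0 : ℝ) < n := mod_cast hn
  set t : ℝ := 2 * ((2 * M) ^ (1 / (d : ℝ)) * (n : ℝ) ^ (-(1 / (d : ℝ)))) with ht
  have htd : (t / 2) ^ d = 2 * M / n := by
    rw [ht, mul_div_cancel_left₀ _ two_ne_zero, Real.rpow_neg hn0.le, ← div_eq_mul_inv, div_pow,
      one_div, Real.rpow_inv_natCast_pow (by positivity) hd.ne',
      Real.rpow_inv_natCast_pow hn0.le hd.ne']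
  have hlt (α : Finset E) (hα : IsWeightSeparated σ t α) : α.card < n := by
    have hle := hcard t (by positivity) α hα
    rw [htd, ← mul_div_assoc, div_le_iff₀ hn0] at hle
    exact_mod_cast (show (α.card : ℝ) < n by nlinarith)
  convert exists_infDist_le_of_isWeightSeparated_card_lt (by positivity) (by positivity) hlt
    using 6
  rw [ht]
  ring

end Pierce

section QuantizationError

variable {E : Type*} [NormedAddCommGroup E] [MeasurableSpace E] {P : Measure E} {r : ℝ}

theorem quantizationError_rpow_eq_iInf (hr : 0 < r) (n : ℕ) :
    quantizationError P r n ^ r =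
      ⨅ (α : Finset E) (_ : α.Nonempty) (_ : α.card ≤ n), distortion P r α := by
  have h := fun x : ℝ≥0∞ => ENNReal.rpow_inv_rpow hr.ne' x
  simp only [quantizationError, one_div]
  simp_rw [← ENNReal.orderIsoRpow_apply r hr, OrderIso.map_iInf, ENNReal.orderIsoRpow_apply, h]

theorem quantizationError_rpow_le_distortion (hr : 0 < r) {n : ℕ} {α : Finset E}
    (hα : α.Nonempty) (hn : α.card ≤ n) : quantizationError P r n ^ r ≤ distortion P r α := by
  rw [quantizationError_rpow_eq_iInf hr]
  exact iInf₂_le_of_le α hα (iInf_le _ hn)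

theorem exists_distortion_lt (hr : 0 < r) {n : ℕ} {c : ℝ≥0∞}
    (hc : quantizationError P r n ^ r < c) :
    ∃ α : Finset E, α.Nonempty ∧ α.card ≤ n ∧ distortion P r α < c := by
  simpa only [quantizationError_rpow_eq_iInf hr, iInf_lt_iff, exists_prop] using hc

theorem exists_forall_distortion_le_add (hr : 0 < r)
    (hfin : ∀ n, 1 ≤ n → quantizationError P r n ^ r ≠ ∞) {ε : ℕ → ℝ≥0∞}
    (hε : ∀ n, 1 ≤ n → ε n ≠ 0) :
    ∃ α : ℕ → Finset E, ∀ n, 1 ≤ n → (α n).Nonempty ∧ (α n).card ≤ n ∧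
      distortion P r (α n) ≤ quantizationError P r n ^ r + ε n := by
  choose! α hne hcard hα using fun (n : ℕ) (hn : 1 ≤ n) =>
    exists_distortion_lt hr (ENNReal.lt_add_right (hfin n hn) (hε n hn))
  exact ⟨α, fun n hn => ⟨hne n hn, hcard n hn, (hα n hn).le⟩⟩

theorem distortion_le_of_infDist_le (hr : 0 ≤ r) {σ c : ℝ} (hc : 0 ≤ c) {α : Finset E}
    (h : ∀ x, infDist x (α : Set E) ≤ c * weight σ x) :
    distortion P r α ≤
      ENNReal.ofReal c ^ r * ∫⁻ x, ENNReal.ofReal (weight σ x) ^ r ∂P := by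
  rw [← lintegral_const_mul' _ _ (by finiteness)]
  refine lintegral_mono fun x => ?_
  rw [← ENNReal.mul_rpow_of_nonneg _ _ hr, ← ENNReal.ofReal_mul hc]
  gcongr
  exact h x

theorem quantizationError_rpow_eq_zero_of_subsingleton_support [HereditarilyLindelofSpace E]
    (hr : 0 < r) (hP : P.support.Subsingleton) {n : ℕ} (hn : 1 ≤ n) :
    quantizationError P r n ^ r = 0 := by
  obtain ⟨a, ha⟩ : ∃ a, P.support ⊆ {a} := by
    rcases hP.eq_empty_or_singleton with h | ⟨a, h⟩
    · exact ⟨0, by simp [h]⟩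
    · exact ⟨a, h.subset⟩
  have hzero : distortion P r {a} = 0 := by
    refine lintegral_eq_zero_of_ae_eq_zero ?_
    filter_upwards [Measure.support_mem_ae (μ := P)] with x hx
    simp [Set.mem_singleton_iff.1 (ha hx), hr]
  exact le_zero_iff.1 (hzero ▸ quantizationError_rpow_le_distortion hr (by simp) (by simpa))

theorem tendsto_zero_of_le_mul_rpow_neg {q : ℝ} (hq : 0 < q) {K : ℝ≥0∞} (hK : K ≠ ∞)
    {u : ℕ → ℝ≥0∞} (hu : ∀ᶠ n in atTop, u n ≤ K * (n : ℝ≥0∞) ^ (-q)) :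
    Tendsto u atTop (𝓝 0) := by
  have hpow : Tendsto (fun n : ℕ => (n : ℝ≥0∞) ^ (-q)) atTop (𝓝 0) := by
    simpa only [ENNReal.rpow_neg, ENNReal.inv_rpow, ENNReal.zero_rpow_of_pos hq] using
      ENNReal.tendsto_inv_nat_nhds_zero.ennrpow_const q
  exact tendsto_of_tendsto_of_tendsto_of_le_of_le' tendsto_const_nhds
    (by simpa using ENNReal.Tendsto.const_mul hpow (.inr hK)) (.of_forall fun _ => zero_le) hu

variable [NormedSpace ℝ E] [FiniteDimensional ℝ E] [Nontrivial E]

theorem exists_quantizationError_rpow_le {σ : ℝ} (hr : 0 < r) (hσ : 1 < σ)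
    (hmom : ∫⁻ x, ENNReal.ofReal (weight σ x) ^ r ∂P ≠ ∞) :
    ∃ K : ℝ≥0∞, K ≠ ∞ ∧ ∀ n : ℕ, 1 ≤ n →
      quantizationError P r n ^ r ≤ K * (n : ℝ≥0∞) ^ (-(r / Module.finrank ℝ E)) := by
  obtain ⟨M, hM, h⟩ := exists_infDist_le_weight (E := E) hσ
  refine ⟨ENNReal.ofReal M ^ r * ∫⁻ x, ENNReal.ofReal (weight σ x) ^ r ∂P,
    ENNReal.mul_ne_top (by finiteness) hmom, fun n hn => ?_⟩
  obtain ⟨α, hne, hcard, hα⟩ := h n hn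
  refine (quantizationError_rpow_le_distortion hr hne hcard).trans
    ((distortion_le_of_infDist_le hr.le (by positivity) hα).trans_eq ?_)
  have hn0 : (0 : ℝ) < n := mod_cast hn
  rw [ENNReal.ofReal_mul hM.le, ENNReal.mul_rpow_of_nonneg _ _ hr.le,
    ← ENNReal.ofReal_rpow_of_pos hn0, ENNReal.ofReal_natCast, ← ENNReal.rpow_mul, mul_right_comm]
  congr 2
  ring

theorem quantizationError_rpow_ne_top {σ : ℝ} (hr : 0 < r) (hσ : 1 < σ)
    (hmom : ∫⁻ x, ENNReal.ofReal (weight σ x) ^ r ∂P ≠ ∞) {n : ℕ} (hn : 1 ≤ n) :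
    quantizationError P r n ^ r ≠ ∞ := by
  obtain ⟨K, hK, h⟩ := exists_quantizationError_rpow_le hr hσ hmom
  refine ne_top_of_le_ne_top (ENNReal.mul_ne_top hK ?_) (h n hn)
  simp [ENNReal.rpow_eq_top_iff, Nat.one_le_iff_ne_zero.1 hn]

theorem IsOptimalSequence.tendsto_distortion {σ : ℝ} (hr : 0 < r) (hσ : 1 < σ)
    (hmom : ∫⁻ x, ENNReal.ofReal (weight σ x) ^ r ∂P ≠ ∞) {α : ℕ → Finset E}
    (hα : IsOptimalSequence P r α) :
    Tendsto (fun n => distortion P r (α n)) atTop (𝓝 0) := by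
  obtain ⟨K, hK, h⟩ := exists_quantizationError_rpow_le hr hσ hmom
  refine tendsto_zero_of_le_mul_rpow_neg (div_pos hr (mod_cast Module.finrank_pos)) hK
    ((eventually_ge_atTop 1).mono fun n hn => (hα n hn).2.2 ▸ h n hn)

theorem exists_near_optimal_sequence {σ : ℝ} (hr : 0 < r) (hσ : 1 < σ)
    (hmom : ∫⁻ x, ENNReal.ofReal (weight σ x) ^ r ∂P ≠ ∞) :
    ∃ K : ℝ≥0∞, K ≠ ∞ ∧ ∃ β : ℕ → Finset E, ∀ n, 1 ≤ n → (β n).Nonempty ∧ (β n).card ≤ n ∧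
      distortion P r (β n) ≤ quantizationError P r n ^ r +
        (n : ℝ≥0∞) ^ (-(1 + r / Module.finrank ℝ E)) ∧
      distortion P r (β n) ≤ K * (n : ℝ≥0∞) ^ (-(r / Module.finrank ℝ E)) := by
  obtain ⟨K, hK, hPierce⟩ := exists_quantizationError_rpow_le hr hσ hmom
  set q := r / Module.finrank ℝ E
  obtain ⟨β, hβ⟩ := exists_forall_distortion_le_add hr
    (fun n hn => quantizationError_rpow_ne_top hr hσ hmom hn)
    (ε := fun n => (n : ℝ≥0∞) ^ (-(1 + q)))
    (fun n hn => by simp [ENNReal.rpow_eq_zero_iff, Nat.one_le_iff_ne_zero.1 hn])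
  refine ⟨K + 1, by finiteness, β, fun n hn => ⟨(hβ n hn).1, (hβ n hn).2.1, (hβ n hn).2.2, ?_⟩⟩
  calc distortion P r (β n) ≤ K * (n : ℝ≥0∞) ^ (-q) + (n : ℝ≥0∞) ^ (-(1 + q)) :=
        (hβ n hn).2.2.trans (by gcongr; exact hPierce n hn)
    _ ≤ K * (n : ℝ≥0∞) ^ (-q) + (n : ℝ≥0∞) ^ (-q) := by
        gcongr
        · exact mod_cast hn
        · linarith
    _ = (K + 1) * (n : ℝ≥0∞) ^ (-q) := by rw [add_mul, one_mul]

end QuantizationError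

section Nearest

variable {E : Type*} [MeasurableSpace E]

theorem exists_measurable_nearest [PseudoMetricSpace E] [OpensMeasurableSpace E] {α : Finset E}
    (hα : α.Nonempty) :
    ∃ π : E → E, Measurable π ∧ ∀ x, π x ∈ α ∧ infDist x (α : Set E) = dist x (π x) := by
  obtain ⟨e, he⟩ := α.countable_toSet.exists_eq_range hα
  choose! i hi using fun a (ha : a ∈ α) => (he ▸ ha : a ∈ Set.range e)
  let π := SimpleFunc.nearestPt e (α.sup i)
  have hmem (x : E) : π x ∈ α := by
    rw [← Finset.mem_coe, he]
    exact Set.mem_range_self (SimpleFunc.nearestPtInd e (α.sup i) x)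
  refine ⟨π, π.measurable, fun x => ⟨hmem x, (infDist_le_dist_of_mem (hmem x)).antisymm ?_⟩⟩
  refine (le_infDist hα).2 fun a ha => ?_
  have hle := SimpleFunc.edist_nearestPt_le e x (Finset.le_sup (f := i) ha)
  rw [hi a ha, edist_comm, edist_comm a, edist_dist, edist_dist] at hle
  exact (ENNReal.ofReal_le_ofReal_iff dist_nonneg).1 hle

theorem sum_setLIntegral_preimage_singleton [MeasurableSingletonClass E] {α : Finset E}
    {π : E → E} (hπ : Measurable π) (hmem : ∀ x, π x ∈ α) (P : Measure E) (g : E → ℝ≥0∞) :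
    ∑ a ∈ α, ∫⁻ x in π ⁻¹' {a}, g x ∂P = ∫⁻ x, g x ∂P := by
  have hcover : ⋃ a ∈ α, π ⁻¹' {a} = Set.univ := by
    ext x
    simp [hmem x]
  rw [← lintegral_biUnion_finset (Set.pairwiseDisjoint_fiber π α)
    fun a _ => hπ (measurableSet_singleton a), hcover, setLIntegral_univ]

end Nearest

section Erase

variable {E : Type*} [NormedAddCommGroup E] [MeasurableSpace E]

theorem sum_weight_rpow_mul_measure_preimage_le [MeasurableSingletonClass E] (P : Measure E)
    {σ r R : ℝ} (hσ : 0 ≤ σ) (hr : 0 ≤ r) {α : Finset E} {π : E → E} (hπ : Measurable π)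
    (hnear : ∀ x, π x ∈ α ∧ infDist x (α : Set E) = dist x (π x)) (hR : ∃ a ∈ α, ‖a‖ ≤ R) :
    ∑ a ∈ α, ENNReal.ofReal (weight σ a) ^ r * P (π ⁻¹' {a}) ≤
      ENNReal.ofReal ((2 + R) ^ σ) ^ r * ∫⁻ x, ENNReal.ofReal (weight σ x) ^ r ∂P := by
  obtain ⟨a₀, ha₀, ha₀R⟩ := hR
  have hR0 : 0 ≤ R := (norm_nonneg a₀).trans ha₀R
  have hweight (x : E) : weight σ (π x) ≤ (2 + R) ^ σ * weight σ x := by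
    have hdist : ‖π x - x‖ ≤ (1 + R) * (1 + ‖x‖) := by
      calc ‖π x - x‖ = infDist x (α : Set E) := by rw [(hnear x).2, dist_comm, dist_eq_norm]
        _ ≤ ‖x - a₀‖ := by simpa [dist_eq_norm] using infDist_le_dist_of_mem (x := x) ha₀
        _ ≤ ‖x‖ + R := (norm_sub_le x a₀).trans (by gcongr)
        _ ≤ (1 + R) * (1 + ‖x‖) := by nlinarith [norm_nonneg x]
    convert weight_le_of_norm_sub_le hσ hdist using 3
    ring
  calc ∑ a ∈ α, ENNReal.ofReal (weight σ a) ^ r * P (π ⁻¹' {a})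
      = ∑ a ∈ α, ∫⁻ x in π ⁻¹' {a}, ENNReal.ofReal (weight σ (π x)) ^ r ∂P := by
        refine Finset.sum_congr rfl fun a _ => ?_
        rw [← setLIntegral_const]
        refine setLIntegral_congr_fun (hπ (measurableSet_singleton a)) fun x hx => ?_
        rw [Set.mem_singleton_iff.1 hx]
    _ = ∫⁻ x, ENNReal.ofReal (weight σ (π x)) ^ r ∂P :=
        sum_setLIntegral_preimage_singleton hπ (fun x => (hnear x).1) P _
    _ ≤ ∫⁻ x, ENNReal.ofReal ((2 + R) ^ σ) ^ r * ENNReal.ofReal (weight σ x) ^ r ∂P := by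
        refine lintegral_mono fun x => ?_
        rw [← ENNReal.mul_rpow_of_nonneg _ _ hr, ← ENNReal.ofReal_mul (by positivity)]
        gcongr
        exact hweight x
    _ = _ := lintegral_const_mul' _ _ (by finiteness)

variable [DecidableEq E]

theorem distortion_erase_le [OpensMeasurableSpace E] (P : Measure E) {r : ℝ} (hr : 0 ≤ r)
    {α : Finset E} {π : E → E} (hπ : Measurable π)
    (hnear : ∀ x, π x ∈ α ∧ infDist x (α : Set E) = dist x (π x)) (a : E) :
    distortion P r (α.erase a) ≤ distortion P r α +
      2 ^ r * (∫⁻ x in π ⁻¹' {a}, ENNReal.ofReal (infDist x (α : Set E)) ^ r ∂P +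
        ENNReal.ofReal (infDist a (α.erase a : Set E)) ^ r * P (π ⁻¹' {a})) := by
  have hcell : MeasurableSet (π ⁻¹' {a}) := hπ (measurableSet_singleton a)
  unfold distortion
  rw [← lintegral_add_compl _ hcell, add_comm]
  refine add_le_add ?_ ?_
  · refine (setLIntegral_mono' hcell.compl fun x hx => ?_).trans (setLIntegral_le_lintegral _ _)
    gcongr
    rw [(hnear x).2]
    exact infDist_le_dist_of_mem (Finset.mem_coe.2 (Finset.mem_erase.2 ⟨hx, (hnear x).1⟩))
  · rw [← setLIntegral_const, ← lintegral_add_right _ measurable_const,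
      ← lintegral_const_mul' _ _ (by finiteness)]
    refine setLIntegral_mono' hcell fun x hx => ?_
    have htri : infDist x (α.erase a : Set E) ≤
        infDist x (α : Set E) + infDist a (α.erase a : Set E) := by
      rw [(hnear x).2, Set.mem_singleton_iff.1 hx, add_comm]
      exact infDist_le_infDist_add_dist
    refine le_trans ?_ (ENNReal.add_rpow_le_two_rpow_mul_rpow_add_rpow _ _ hr)
    rw [← ENNReal.ofReal_add infDist_nonneg infDist_nonneg]
    gcongr

variable [NormedSpace ℝ E] [FiniteDimensional ℝ E] [Nontrivial E]

theorem ofReal_rpow_mul_eq_mul_ofReal_div_pow_rpow {δ w r : ℝ} (hδ : 0 ≤ δ) (hw : 0 < w)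
    (hr : 0 ≤ r) {d : ℕ} (hd : d ≠ 0) (c : ℝ≥0∞) :
    ENNReal.ofReal δ ^ r * c =
      ENNReal.ofReal w ^ r * c * ENNReal.ofReal ((δ / w) ^ d) ^ (r / d) := by
  rw [ENNReal.ofReal_pow (by positivity), ← ENNReal.rpow_natCast, ← ENNReal.rpow_mul,
    mul_div_cancel₀ r (mod_cast hd), mul_right_comm, ← ENNReal.mul_rpow_of_nonneg _ _ hr,
    ← ENNReal.ofReal_mul hw.le, mul_div_cancel₀ δ hw.ne']

theorem add_mul_rpow_le_of_add_le_div {I A G S N : ℝ≥0∞} {q : ℝ} (hq : 0 ≤ q) (hN : N ≠ 0)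
    (hN' : N ≠ ∞) (h : I * N ^ q + A + G ≤ S / N) :
    I + A * G ^ q ≤ (S + S ^ (1 + q)) * N ^ (-(1 + q)) := by
  have hI : I * N ^ q ≤ S / N := (le_self_add.trans le_self_add).trans h
  have hA : A ≤ S / N := (le_add_self.trans le_self_add).trans h
  have hG : G ≤ S / N := le_add_self.trans h
  rw [add_mul]
  refine add_le_add ?_ ?_
  · rw [← ENNReal.le_div_iff_mul_le (.inl (by simp [hN, hN'])) (.inl (by finiteness))] at hI
    rwa [neg_add, ENNReal.rpow_add _ _ hN hN', ENNReal.rpow_neg_one, ENNReal.rpow_neg,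
      ← mul_assoc]
  · calc A * G ^ q ≤ S / N * (S / N) ^ q := by gcongr
      _ = (S / N) ^ (1 + q) := by
          rw [ENNReal.rpow_add_of_nonneg _ _ zero_le_one hq, ENNReal.rpow_one]
      _ = S ^ (1 + q) * N ^ (-(1 + q)) := by
          rw [ENNReal.div_rpow_of_nonneg _ _ (by positivity), ENNReal.rpow_neg, div_eq_mul_inv]

theorem exists_distortion_erase_le [OpensMeasurableSpace E] (P : Measure E) {σ r : ℝ}
    (hr : 0 ≤ r) (hσ : 1 < σ) (hmom : ∫⁻ x, ENNReal.ofReal (weight σ x) ^ r ∂P ≠ ∞) (R : ℝ)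
    {K : ℝ≥0∞} (hK : K ≠ ∞) :
    ∃ K' : ℝ≥0∞, K' ≠ ∞ ∧ ∀ α : Finset E, (∀ a, ∃ a' ∈ α, a' ≠ a ∧ ‖a'‖ ≤ R) →
      distortion P r α ≤ K * (α.card : ℝ≥0∞) ^ (-(r / Module.finrank ℝ E)) →
      ∃ a ∈ α, distortion P r (α.erase a) ≤
        distortion P r α + K' * (α.card : ℝ≥0∞) ^ (-(1 + r / Module.finrank ℝ E)) := by
  obtain ⟨M, hpack⟩ := exists_sum_infDist_erase_div_weight_pow_le (E := E) hσ R
  set q := r / Module.finrank ℝ E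
  let S := K + ENNReal.ofReal ((2 + R) ^ σ) ^ r * ∫⁻ x, ENNReal.ofReal (weight σ x) ^ r ∂P +
    ENNReal.ofReal M
  have hS' : S ≠ ∞ := by finiteness
  refine ⟨2 ^ r * (S + S ^ (1 + q)), by finiteness, fun α hR hα => ?_⟩
  obtain ⟨a₀, ha₀, -, ha₀R⟩ := hR 0
  have hne : α.Nonempty := ⟨a₀, ha₀⟩
  obtain ⟨π, hπ, hnear⟩ := exists_measurable_nearest hne
  have hN : (α.card : ℝ≥0∞) ≠ 0 := mod_cast hne.card_ne_zero
  let I (a : E) := ∫⁻ x in π ⁻¹' {a}, ENNReal.ofReal (infDist x (α : Set E)) ^ r ∂P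
  let A (a : E) := ENNReal.ofReal (weight σ a) ^ r * P (π ⁻¹' {a})
  let G (a : E) :=
    ENNReal.ofReal ((infDist a (α.erase a : Set E) / weight σ a) ^ Module.finrank ℝ E)
  have hIsum : ∑ a ∈ α, I a * (α.card : ℝ≥0∞) ^ q ≤ K := by
    rw [← Finset.sum_mul, sum_setLIntegral_preimage_singleton hπ fun x => (hnear x).1]
    rw [ENNReal.rpow_neg, ← div_eq_mul_inv] at hα
    exact ENNReal.mul_le_of_le_div hα
  have hAsum := sum_weight_rpow_mul_measure_preimage_le P (zero_le_one.trans hσ.le) hr hπ hnear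
    ⟨a₀, ha₀, ha₀R⟩
  have hGsum : ∑ a ∈ α, G a ≤ ENNReal.ofReal M := by
    rw [← ENNReal.ofReal_sum_of_nonneg fun a _ =>
      pow_nonneg (div_nonneg infDist_nonneg (weight_pos σ a).le) _]
    exact ENNReal.ofReal_le_ofReal (hpack α hR)
  -- Pigeonhole on the sum of the three costs yields one point at which all of them are small.
  obtain ⟨a, ha, hle⟩ : ∃ a ∈ α, I a * (α.card : ℝ≥0∞) ^ q + A a + G a ≤ S / α.card := by
    refine ENNReal.exists_le_of_sum_le hne ?_
    rw [Finset.sum_const, nsmul_eq_mul, ENNReal.mul_div_cancel hN (by finiteness),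
      Finset.sum_add_distrib, Finset.sum_add_distrib]
    exact add_le_add (add_le_add hIsum hAsum) hGsum
  refine ⟨a, ha, (distortion_erase_le P hr hπ hnear a).trans ?_⟩
  rw [mul_assoc, ofReal_rpow_mul_eq_mul_ofReal_div_pow_rpow infDist_nonneg (weight_pos σ a) hr
    (Module.finrank_pos (R := ℝ) (M := E)).ne']
  gcongr
  exact add_mul_rpow_le_of_add_le_div (by positivity) hN (by finiteness) hle

end Erase

section Increments

variable {E : Type*} [NormedAddCommGroup E] [MeasurableSpace E] [OpensMeasurableSpace E]
  {P : Measure E} {r : ℝ}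

theorem tendsto_infDist_of_mem_support (hr : 0 ≤ r) {ι : Type*} {l : Filter ι}
    {α : ι → Finset E} (hlim : Tendsto (fun i => distortion P r (α i)) l (𝓝 0)) {x : E}
    (hx : x ∈ P.support) : Tendsto (fun i => infDist x (α i : Set E)) l (𝓝 0) := by
  rw [Metric.tendsto_nhds]
  intro ε hε
  have hball : 0 < P (ball x (ε / 2)) :=
    (Measure.mem_support_iff_forall x).1 hx _ (ball_mem_nhds x (half_pos hε))
  have hpos : 0 < ENNReal.ofReal (ε / 2) ^ r * P (ball x (ε / 2)) :=
    ENNReal.mul_pos (ENNReal.rpow_pos (by simpa using hε) ENNReal.ofReal_ne_top).ne' hball.ne'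
  filter_upwards [hlim.eventually (gt_mem_nhds hpos)] with i hi
  rw [Real.dist_eq, sub_zero, abs_of_nonneg infDist_nonneg]
  by_contra! hfar
  refine hi.not_ge ?_
  rw [← setLIntegral_const]
  refine (setLIntegral_mono' measurableSet_ball fun z hz => ?_).trans
    (setLIntegral_le_lintegral _ _)
  have hxz : infDist x (α i : Set E) ≤ infDist z (α i : Set E) + dist x z :=
    infDist_le_infDist_add_dist
  gcongr
  linarith [mem_ball'.1 hz]

theorem exists_eventually_exists_ne_norm_le (hr : 0 ≤ r) (hP : P.support.Nontrivial) {ι : Type*}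
    {l : Filter ι} {α : ι → Finset E} (hne : ∀ᶠ i in l, (α i).Nonempty)
    (hlim : Tendsto (fun i => distortion P r (α i)) l (𝓝 0)) :
    ∃ R : ℝ, ∀ᶠ i in l, ∀ a, ∃ a' ∈ α i, a' ≠ a ∧ ‖a'‖ ≤ R := by
  obtain ⟨x, hx, y, hy, hxy⟩ := hP
  have hε : 0 < dist x y / 2 := half_pos (dist_pos.2 hxy)
  have hclose {z : E} (hz : z ∈ P.support) : ∀ᶠ i in l, ∃ a ∈ α i, dist z a < dist x y / 2 := by
    filter_upwards [(tendsto_infDist_of_mem_support hr hlim hz).eventually (gt_mem_nhds hε), hne]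
      with i hi hnei
    exact (infDist_lt_iff hnei).1 hi
  have hnorm {z a : E} (h : dist z a < dist x y / 2) : ‖a‖ ≤ ‖z‖ + dist x y / 2 := by
    rw [dist_comm, dist_eq_norm] at h
    linarith [norm_le_norm_add_norm_sub' a z]
  refine ⟨max ‖x‖ ‖y‖ + dist x y / 2, ?_⟩
  filter_upwards [hclose hx, hclose hy] with i ⟨u, hu, hxu⟩ ⟨v, hv, hyv⟩ a
  rcases ne_or_eq u a with hua | rfl
  · exact ⟨u, hu, hua, (hnorm hxu).trans (by gcongr; exact le_max_left _ _)⟩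
  · refine ⟨v, hv, ?_, (hnorm hyv).trans (by gcongr; exact le_max_right _ _)⟩
    rintro rfl
    linarith [dist_triangle_right x y v]

variable [NormedSpace ℝ E] [FiniteDimensional ℝ E] [Nontrivial E]

theorem exists_quantizationError_rpow_le_succ_add {σ : ℝ} (hr : 0 < r) (hσ : 1 < σ)
    (hmom : ∫⁻ x, ENNReal.ofReal (weight σ x) ^ r ∂P ≠ ∞) :
    ∃ K : ℝ≥0∞, K ≠ ∞ ∧ ∀ᶠ n : ℕ in atTop, quantizationError P r n ^ r ≤
      quantizationError P r (n + 1) ^ r +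
        K * (n : ℝ≥0∞) ^ (-(1 + r / Module.finrank ℝ E)) := by
  classical
  rcases P.support.subsingleton_or_nontrivial with hP | hP
  · refine ⟨0, ENNReal.zero_ne_top, (eventually_ge_atTop 1).mono fun n hn => ?_⟩
    simp [quantizationError_rpow_eq_zero_of_subsingleton_support hr hP hn]
  obtain ⟨K, hK, β, hβ⟩ := exists_near_optimal_sequence hr hσ hmom
  have hq : 0 < r / Module.finrank ℝ E := div_pos hr (mod_cast Module.finrank_pos)
  have hlim : Tendsto (fun n => distortion P r (β n)) atTop (𝓝 0) :=
    tendsto_zero_of_le_mul_rpow_neg hq hK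
      ((eventually_ge_atTop 1).mono fun n hn => (hβ n hn).2.2.2)
  obtain ⟨R, hR⟩ := exists_eventually_exists_ne_norm_le hr.le hP
    ((eventually_ge_atTop 1).mono fun n hn => (hβ n hn).1) hlim
  obtain ⟨K', hK', herase⟩ := exists_distortion_erase_le P hr.le hσ hmom R hK
  refine ⟨1 + K', by finiteness, ?_⟩
  filter_upwards [(tendsto_add_atTop_nat 1).eventually hR] with n hRn
  obtain ⟨hne, hcard, hopt, hsmall⟩ := hβ (n + 1) (Nat.le_add_left 1 n)
  have hpow : ((n + 1 : ℕ) : ℝ≥0∞) ^ (-(1 + r / Module.finrank ℝ E)) ≤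
      (n : ℝ≥0∞) ^ (-(1 + r / Module.finrank ℝ E)) := by
    simp only [ENNReal.rpow_neg, ENNReal.inv_le_inv]
    gcongr
    exact Nat.le_succ n
  have hdist : distortion P r (β (n + 1)) ≤ quantizationError P r (n + 1) ^ r +
      (n : ℝ≥0∞) ^ (-(1 + r / Module.finrank ℝ E)) := hopt.trans (add_le_add le_rfl hpow)
  rw [add_mul, one_mul, ← add_assoc]
  rcases hcard.lt_or_eq with hlt | heq
  · exact (quantizationError_rpow_le_distortion hr hne (Nat.lt_succ_iff.1 hlt)).trans
      (hdist.trans le_self_add)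
  · obtain ⟨a, ha, hle⟩ := herase (β (n + 1)) hRn (by rwa [heq])
    obtain ⟨a', ha', hne', -⟩ := hRn a
    calc quantizationError P r n ^ r ≤ distortion P r ((β (n + 1)).erase a) :=
          quantizationError_rpow_le_distortion hr ⟨a', Finset.mem_erase.2 ⟨hne', ha'⟩⟩
            (by rw [Finset.card_erase_of_mem ha, heq, Nat.add_sub_cancel])
      _ ≤ _ := hle
      _ ≤ _ := by
          rw [heq]
          gcongr

end Increments

section Gain

variable {E : Type*} [NormedAddCommGroup E] [MeasurableSpace E] [OpensMeasurableSpace E]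
  {P : Measure E} {r b : ℝ}

theorem distortion_insert_add_le [DecidableEq E] (hr : 0 ≤ r) (hb : 0 ≤ b) (hb' : b ≤ 1 / 2)
    {α : Finset E} (hα : α.Nonempty) (x : E) :
    distortion P r (insert x α) + ENNReal.ofReal ((1 - b) ^ r - b ^ r) *
      ENNReal.ofReal (infDist x (α : Set E)) ^ r *
        P (closedBall x (b * infDist x (α : Set E))) ≤ distortion P r α := by
  set ρ := infDist x (α : Set E)
  have hb1 : 0 ≤ 1 - b := by linarith
  have hc : 0 ≤ (1 - b) ^ r - b ^ r := sub_nonneg.2 (by gcongr; linarith)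
  have hball : MeasurableSet (closedBall x (b * ρ)) := isClosed_closedBall.measurableSet
  unfold distortion
  rw [← setLIntegral_const, ← lintegral_indicator hball,
    ← lintegral_add_right _ (measurable_const.indicator hball)]
  refine lintegral_mono fun z => ?_
  by_cases hz : z ∈ closedBall x (b * ρ)
  · have hnear : infDist z (insert x α : Finset E) ≤ b * ρ :=
      (infDist_le_dist_of_mem (by simp)).trans hz
    have hfar : (1 - b) * ρ ≤ infDist z (α : Set E) := by
      have hxz : ρ ≤ infDist z (α : Set E) + dist x z := infDist_le_infDist_add_dist
      linarith [mem_closedBall'.1 hz]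
    rw [Set.indicator_of_mem hz]
    calc _ ≤ ENNReal.ofReal (b * ρ) ^ r +
          ENNReal.ofReal ((1 - b) ^ r - b ^ r) * ENNReal.ofReal ρ ^ r := by gcongr
      _ = ENNReal.ofReal ((1 - b) * ρ) ^ r := by
          simp only [ENNReal.ofReal_mul hb, ENNReal.ofReal_mul hb1,
            ENNReal.mul_rpow_of_nonneg _ _ hr]
          rw [← add_mul, ENNReal.ofReal_rpow_of_nonneg hb hr, ENNReal.ofReal_rpow_of_nonneg hb1 hr,
            ← ENNReal.ofReal_add (by positivity) hc, add_sub_cancel]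
      _ ≤ _ := by gcongr
  · rw [Set.indicator_of_notMem hz, add_zero]
    gcongr
    exact infDist_le_infDist_of_subset (by simp) hα

theorem quantizationError_rpow_succ_add_le (hr : 0 < r) (hb : 0 ≤ b) (hb' : b ≤ 1 / 2)
    {α : Finset E} (hα : α.Nonempty) {n : ℕ} (hn : α.card ≤ n) (x : E) :
    quantizationError P r (n + 1) ^ r + ENNReal.ofReal ((1 - b) ^ r - b ^ r) *
      ENNReal.ofReal (infDist x (α : Set E)) ^ r *
        P (closedBall x (b * infDist x (α : Set E))) ≤ distortion P r α := by
  classical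
  refine le_trans ?_ (distortion_insert_add_le hr.le hb hb' hα x)
  gcongr
  exact quantizationError_rpow_le_distortion hr (Finset.insert_nonempty x α)
    ((Finset.card_insert_le x α).trans (Nat.succ_le_succ hn))

end Gain

section BallRatio

/-- The quotient `vol(B(x, ρ)) / P(B(x, ρ))` for the closed ball `B(x, ρ)`, whose supremum over
`ρ = b d(x, α_n)` is the maximal function `ψ_b`. Since `0 / 0 = 0`, it vanishes at
`ρ = 0` when `vol` has no atoms. -/
noncomputable def ballRatio {E : Type*} [PseudoMetricSpace E] [MeasurableSpace E]
    (vol P : Measure E) (x : E) (ρ : ℝ) : ℝ≥0∞ :=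
  vol (closedBall x ρ) / P (closedBall x ρ)

variable {E : Type*} [NormedAddCommGroup E] [NormedSpace ℝ E] [FiniteDimensional ℝ E]
  [MeasurableSpace E] [BorelSpace E]

theorem ofReal_rpow_le_mul_ballRatio (vol : Measure E) [vol.IsAddHaarMeasure] {P : Measure E}
    {r b ρ : ℝ} (hb : 0 < b) (hρ : 0 < ρ) {x : E} {A : ℝ≥0∞} (hA : A ≠ 0) (hA' : A ≠ ∞)
    (h : ENNReal.ofReal ρ ^ r * P (closedBall x (b * ρ)) ≤ A) :
    ENNReal.ofReal ρ ^ (Module.finrank ℝ E + r) ≤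
      A / (ENNReal.ofReal b ^ Module.finrank ℝ E * vol (ball 0 1)) *
        ballRatio vol P x (b * ρ) := by
  set d := Module.finrank ℝ E
  have hv0 : ENNReal.ofReal b ^ d * vol (ball 0 1) ≠ 0 :=
    mul_ne_zero (pow_ne_zero _ (by simpa using hb)) (measure_ball_pos vol 0 one_pos).ne'
  have hvtop : ENNReal.ofReal b ^ d * vol (ball 0 1) ≠ ∞ := by finiteness
  have hvol : vol (closedBall x (b * ρ)) =
      ENNReal.ofReal ρ ^ d * (ENNReal.ofReal b ^ d * vol (ball 0 1)) := by
    rw [Measure.addHaar_closedBall vol x (by positivity), ENNReal.ofReal_pow (by positivity),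
      ENNReal.ofReal_mul hb.le]
    ring
  have hnum : A / (ENNReal.ofReal b ^ d * vol (ball 0 1)) * vol (closedBall x (b * ρ)) ≠ 0 :=
    mul_ne_zero (ENNReal.div_ne_zero.2 ⟨hA, hvtop⟩)
      (measure_closedBall_pos vol x (mul_pos hb hρ)).ne'
  have hfin : A / (ENNReal.ofReal b ^ d * vol (ball 0 1)) * vol (closedBall x (b * ρ)) ≠ ∞ :=
    ENNReal.mul_ne_top (ENNReal.div_ne_top hA' hv0) measure_closedBall_lt_top.ne
  rw [ballRatio, ← mul_div_assoc, ENNReal.le_div_iff_mul_le (.inr hnum) (.inr hfin)]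
  calc ENNReal.ofReal ρ ^ (d + r) * P (closedBall x (b * ρ))
      = ENNReal.ofReal ρ ^ d * (ENNReal.ofReal ρ ^ r * P (closedBall x (b * ρ))) := by
        rw [ENNReal.rpow_add _ _ (by simpa using hρ) (by finiteness), ENNReal.rpow_natCast,
          mul_assoc]
    _ ≤ ENNReal.ofReal ρ ^ d * A := by gcongr
    _ = A / (ENNReal.ofReal b ^ d * vol (ball 0 1)) * vol (closedBall x (b * ρ)) := by
        rw [hvol, mul_left_comm, ENNReal.div_mul_cancel hv0 hvtop]

variable [Nontrivial E]

theorem exists_rpow_infDist_mul_measure_closedBall_le {P : Measure E} {σ r b : ℝ} (hr : 0 < r)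
    (hσ : 1 < σ) (hmom : ∫⁻ x, ENNReal.ofReal (weight σ x) ^ r ∂P ≠ ∞) (hb : 0 ≤ b)
    (hb' : b < 1 / 2) :
    ∃ K : ℝ≥0∞, K ≠ ∞ ∧ ∀ α : ℕ → Finset E, IsOptimalSequence P r α → ∀ᶠ n : ℕ in atTop, ∀ x,
      ENNReal.ofReal (infDist x (α n : Set E)) ^ r *
          P (closedBall x (b * infDist x (α n : Set E))) ≤
        K * (n : ℝ≥0∞) ^ (-(1 + r / Module.finrank ℝ E)) := by
  obtain ⟨K, hK, hsucc⟩ := exists_quantizationError_rpow_le_succ_add hr hσ hmom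
  set c : ℝ≥0∞ := ENNReal.ofReal ((1 - b) ^ r - b ^ r)
  have hc : c ≠ 0 := by
    rw [ENNReal.ofReal_ne_zero_iff, sub_pos]
    gcongr
    linarith
  refine ⟨K / c, ENNReal.div_ne_top hK hc, fun α hα => ?_⟩
  filter_upwards [hsucc, eventually_ge_atTop 1] with n hn hn1 x
  obtain ⟨hne, hcard, hopt⟩ := hα n hn1
  rw [← ENNReal.mul_div_right_comm,
    ENNReal.le_div_iff_mul_le (.inl hc) (.inl ENNReal.ofReal_ne_top), mul_comm, ← mul_assoc,
    ← ENNReal.add_le_add_iff_left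
      (quantizationError_rpow_ne_top hr hσ hmom (Nat.le_add_left 1 n))]
  exact (quantizationError_rpow_succ_add_le hr hb hb'.le hne hcard x).trans (hopt ▸ hn)

theorem exists_rpow_infDist_le_mul_ballRatio (vol : Measure E) [vol.IsAddHaarMeasure]
    {P : Measure E} {σ r b : ℝ} (hr : 0 < r) (hσ : 1 < σ)
    (hmom : ∫⁻ x, ENNReal.ofReal (weight σ x) ^ r ∂P ≠ ∞) (hb : 0 < b) (hb' : b < 1 / 2) :
    ∃ K : ℝ≥0∞, K ≠ ∞ ∧ ∀ α : ℕ → Finset E, IsOptimalSequence P r α → ∀ᶠ n : ℕ in atTop, ∀ x,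
      ((n : ℝ≥0∞) ^ (1 / Module.finrank ℝ E : ℝ) *
          ENNReal.ofReal (infDist x (α n : Set E))) ^ (Module.finrank ℝ E + r) ≤
        K * ballRatio vol P x (b * infDist x (α n : Set E)) := by
  obtain ⟨K, hK, hgain⟩ := exists_rpow_infDist_mul_measure_closedBall_le hr hσ hmom hb.le hb'
  have hd : 0 < Module.finrank ℝ E := Module.finrank_pos
  set d := Module.finrank ℝ E
  set v : ℝ≥0∞ := ENNReal.ofReal b ^ d * vol (ball 0 1)
  have hv : v ≠ 0 :=
    mul_ne_zero (pow_ne_zero _ (by simpa using hb)) (measure_ball_pos vol 0 one_pos).ne'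
  refine ⟨(K + 1) / v, ENNReal.div_ne_top (by finiteness) hv, fun α hα => ?_⟩
  filter_upwards [hgain α hα, eventually_ge_atTop 1] with n hn hn1 x
  set ρ := infDist x (α n : Set E)
  have hdr : 0 < d + r := by positivity
  rcases (infDist_nonneg (x := x) (s := (α n : Set E))).eq_or_lt' with hρ | hρ
  · simp [ρ, hρ, ENNReal.zero_rpow_of_pos hdr]
  have hN0 : (n : ℝ≥0∞) ≠ 0 := by simpa using Nat.one_le_iff_ne_zero.1 hn1
  have hscale : ((n : ℝ≥0∞) ^ (1 / d : ℝ)) ^ (d + r) = (n : ℝ≥0∞) ^ (1 + r / d) := by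
    rw [← ENNReal.rpow_mul]
    congr 1
    field_simp
  have hball := ofReal_rpow_le_mul_ballRatio vol hb hρ
    (A := (K + 1) * (n : ℝ≥0∞) ^ (-(1 + r / d))) (by simp [ENNReal.rpow_eq_zero_iff, hN0])
    (ENNReal.mul_ne_top (by finiteness) (by simp [ENNReal.rpow_eq_top_iff, hN0]))
    ((hn x).trans (by gcongr; exact le_self_add))
  rw [ENNReal.mul_rpow_of_nonneg _ _ hdr.le, hscale]
  calc _ ≤ (n : ℝ≥0∞) ^ (1 + r / d) * ((K + 1) * (n : ℝ≥0∞) ^ (-(1 + r / d)) / v *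
        ballRatio vol P x (b * ρ)) := by gcongr
    _ = (K + 1) / v * ballRatio vol P x (b * ρ) *
        ((n : ℝ≥0∞) ^ (1 + r / d) * (n : ℝ≥0∞) ^ (-(1 + r / d))) := by
      rw [ENNReal.mul_div_right_comm]
      ring
    _ = (K + 1) / v * ballRatio vol P x (b * ρ) := by
      rw [← ENNReal.rpow_add _ _ hN0 (ENNReal.natCast_ne_top n), add_neg_cancel,
        ENNReal.rpow_zero, mul_one]

end BallRatio

section Differentiation

theorem ae_tendsto_ballRatio {X : Type*} [PseudoMetricSpace X] [ProperSpace X]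
    [MeasurableSpace X] [BorelSpace X] (vol P : Measure X) [IsUnifLocDoublingMeasure vol]
    [vol.IsOpenPosMeasure] [IsFiniteMeasureOnCompacts vol] [IsLocallyFiniteMeasure P] :
    ∀ᵐ x ∂vol, Tendsto (ballRatio vol P x) (𝓝[>] 0) (𝓝 (P.rnDeriv vol x)⁻¹) := by
  filter_upwards [(IsUnifLocDoublingMeasure.vitaliFamily vol 1).ae_tendsto_rnDeriv P] with x hx
  have hball : Tendsto (fun ρ => closedBall x ρ) (𝓝[>] 0)
      ((IsUnifLocDoublingMeasure.vitaliFamily vol 1).filterAt x) :=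
    IsUnifLocDoublingMeasure.tendsto_closedBall_filterAt vol (fun _ => x) id tendsto_id
      (eventually_mem_nhdsWithin.mono fun ρ hρ => by simpa using le_of_lt hρ)
  refine (hx.comp hball).inv.congr' (eventually_mem_nhdsWithin.mono fun ρ hρ => ?_)
  exact ENNReal.inv_div (.inl measure_closedBall_lt_top.ne)
    (.inl (measure_closedBall_pos vol x hρ).ne')

theorem ae_tendsto_ballRatio_infDist {E : Type*} [NormedAddCommGroup E] [ProperSpace E]
    [MeasurableSpace E] [BorelSpace E] (vol : Measure E) [IsUnifLocDoublingMeasure vol]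
    [vol.IsOpenPosMeasure] [IsFiniteMeasureOnCompacts vol] [NullSingletonClass vol]
    {P : Measure E} [IsLocallyFiniteMeasure P]
    (hP : P ≪ vol) {r b : ℝ} (hr : 0 ≤ r) (hb : 0 < b) {α : ℕ → Finset E}
    (hne : ∀ᶠ n in atTop, (α n).Nonempty)
    (hlim : Tendsto (fun n => distortion P r (α n)) atTop (𝓝 0)) :
    ∀ᵐ x ∂P, Tendsto (fun n => ballRatio vol P x (b * infDist x (α n : Set E))) atTop
      (𝓝 (P.rnDeriv vol x)⁻¹) := by
  have hnot : ∀ᵐ x ∂P, ∀ n, x ∉ α n := ae_all_iff.2 fun n =>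
    hP.ae_le (measure_eq_zero_iff_ae_notMem.1 ((α n).finite_toSet.measure_zero vol))
  filter_upwards [hP.ae_le (ae_tendsto_ballRatio vol P), hnot, Measure.support_mem_ae]
    with x hdiff hx hsupp
  refine hdiff.comp (tendsto_nhdsWithin_iff.2
    ⟨by simpa using (tendsto_infDist_of_mem_support hr hlim hsupp).const_mul b, ?_⟩)
  filter_upwards [hne] with n hn
  exact mul_pos hb (((α n).finite_toSet.isClosed.notMem_iff_infDist_pos hn).1 (hx n))

theorem ae_tendsto_ballRatio_infDist_withDensity {E : Type*} [NormedAddCommGroup E]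
    [ProperSpace E] [MeasurableSpace E] [BorelSpace E] (vol : Measure E)
    [IsUnifLocDoublingMeasure vol] [vol.IsOpenPosMeasure] [IsFiniteMeasureOnCompacts vol]
    [NullSingletonClass vol] {f : E → ℝ≥0∞} (hf : Measurable f)
    [IsLocallyFiniteMeasure (vol.withDensity f)] {r b : ℝ} (hr : 0 ≤ r) (hb : 0 < b)
    {α : ℕ → Finset E} (hne : ∀ᶠ n in atTop, (α n).Nonempty)
    (hlim : Tendsto (fun n => distortion (vol.withDensity f) r (α n)) atTop (𝓝 0)) :
    ∀ᵐ x ∂(vol.withDensity f), Tendsto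
      (fun n => ballRatio vol (vol.withDensity f) x (b * infDist x (α n : Set E))) atTop
      (𝓝 (f x)⁻¹) := by
  have hac : vol.withDensity f ≪ vol := withDensity_absolutelyContinuous vol f
  filter_upwards [ae_tendsto_ballRatio_infDist vol hac hr hb hne hlim,
    hac.ae_le (Measure.rnDeriv_withDensity vol hf)] with x hx hfx
  rwa [hfx] at hx

end Differentiation

section Limsup

theorem limsup_lintegral_le_of_le_of_tendsto {X : Type*} [MeasurableSpace X] {ν : Measure X}
    {F G : ℕ → X → ℝ≥0∞} {g H : X → ℝ≥0∞} (hF : ∀ n, Measurable (F n))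
    (hFG : ∀ᶠ n in atTop, F n ≤ G n) (hGH : ∀ᶠ n in atTop, G n ≤ H)
    (hH : ∫⁻ x, H x ∂ν ≠ ∞) (hG : ∀ᵐ x ∂ν, Tendsto (fun n => G n x) atTop (𝓝 (g x))) :
    limsup (fun n => ∫⁻ x, F n x ∂ν) atTop ≤ ∫⁻ x, g x ∂ν := by
  obtain ⟨N, hN⟩ := eventually_atTop.1 (hFG.and hGH)
  rw [← limsup_nat_add _ N]
  refine (limsup_lintegral_le (f := fun n => F (n + N)) H (fun n => hF _) (fun n => ?_) hH).trans
    (lintegral_mono_ae ?_)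
  · obtain ⟨hn, hn'⟩ := hN (n + N) (Nat.le_add_left N n)
    exact .of_forall (hn.trans hn')
  · filter_upwards [hG] with x hx
    rw [limsup_nat_add (fun n => F n x) N, ← hx.limsup_eq]
    exact limsup_le_limsup (hFG.mono fun n hn => hn x)

variable {E : Type*} [NormedAddCommGroup E] [MeasurableSpace E] {vol P ν : Measure E}
  {α : ℕ → Finset E} {f : E → ℝ≥0∞} {b p : ℝ}

theorem ballRatio_le_maximalFunction (x : E) {n : ℕ} (hn : 1 ≤ n) :
    ballRatio vol P x (b * infDist x (α n : Set E)) ≤ maximalFunction vol P α b x :=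
  le_iSup₂_of_le n hn le_rfl

theorem lintegral_rpow_neg_le_lintegral_maximalFunction_rpow (hp : 0 ≤ p)
    (hlim : ∀ᵐ x ∂ν, Tendsto (fun n => ballRatio vol P x (b * infDist x (α n : Set E))) atTop
      (𝓝 (f x)⁻¹)) :
    ∫⁻ x, f x ^ (-p) ∂ν ≤ ∫⁻ x, maximalFunction vol P α b x ^ p ∂ν := by
  refine lintegral_mono_ae ?_
  filter_upwards [hlim] with x hx
  rw [ENNReal.rpow_neg, ← ENNReal.inv_rpow]
  gcongr
  exact le_of_tendsto hx ((eventually_ge_atTop 1).mono fun n => ballRatio_le_maximalFunction x)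

theorem limsup_lintegral_infDist_rpow_le [OpensMeasurableSpace E] {r s d : ℝ} {K : ℝ≥0∞}
    (hd : 0 < d) (hdr : 0 < d + r) (hs : 0 ≤ s) (hK : K ≠ ∞)
    (hbound : ∀ᶠ n : ℕ in atTop, ∀ x,
      ((n : ℝ≥0∞) ^ (1 / d) * ENNReal.ofReal (infDist x (α n : Set E))) ^ (d + r) ≤
        K * ballRatio vol P x (b * infDist x (α n : Set E)))
    (hlim : ∀ᵐ x ∂ν, Tendsto (fun n => ballRatio vol P x (b * infDist x (α n : Set E))) atTop
      (𝓝 (f x)⁻¹))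
    (hψ : ∫⁻ x, maximalFunction vol P α b x ^ (s / (d + r)) ∂ν ≠ ∞) :
    limsup (fun n : ℕ => (n : ℝ≥0∞) ^ (s / d) *
        ∫⁻ x, ENNReal.ofReal (infDist x (α n : Set E)) ^ s ∂ν) atTop ≤
      K ^ (s / (d + r)) * ∫⁻ x, f x ^ (-(s / (d + r))) ∂ν := by
  set p := s / (d + r) with hp
  have hp0 : 0 ≤ p := by positivity
  have hscale (n : ℕ) (x : E) : (n : ℝ≥0∞) ^ (s / d) * ENNReal.ofReal (infDist x (α n : Set E)) ^ s
      = (((n : ℝ≥0∞) ^ (1 / d) * ENNReal.ofReal (infDist x (α n : Set E))) ^ (d + r)) ^ p := by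
    rw [← ENNReal.rpow_mul, hp, mul_div_cancel₀ _ hdr.ne', ENNReal.mul_rpow_of_nonneg _ _ hs,
      ← ENNReal.rpow_mul, one_div_mul_eq_div]
  have hKp : K ^ p ≠ ∞ := ENNReal.rpow_ne_top_of_nonneg hp0 hK
  have hnp (n : ℕ) : (n : ℝ≥0∞) ^ (s / d) ≠ ∞ :=
    ENNReal.rpow_ne_top_of_nonneg (by positivity) (ENNReal.natCast_ne_top n)
  simp only [← lintegral_const_mul' _ _ (hnp _), ← lintegral_const_mul' _ _ hKp]
  refine limsup_lintegral_le_of_le_of_tendsto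
    (G := fun n x => K ^ p * ballRatio vol P x (b * infDist x (α n : Set E)) ^ p)
    (H := fun x => K ^ p * maximalFunction vol P α b x ^ p) (fun n => ?_) ?_ ?_ ?_ ?_
  · exact ((continuous_infDist_pt _).measurable.ennreal_ofReal.pow_const s).const_mul _
  · filter_upwards [hbound] with n hn x
    beta_reduce
    rw [← ENNReal.mul_rpow_of_nonneg _ _ hp0]
    exact (hscale n x).trans_le (by gcongr; exact hn x)
  · filter_upwards [eventually_ge_atTop 1] with n hn x
    beta_reduce
    gcongr
    exact ballRatio_le_maximalFunction x hn
  · rw [lintegral_const_mul' _ _ hKp]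
    exact ENNReal.mul_ne_top hKp hψ
  · filter_upwards [hlim] with x hx
    rw [ENNReal.rpow_neg, ← ENNReal.inv_rpow]
    exact ENNReal.Tendsto.const_mul (hx.ennrpow_const p) (.inr hKp)

end Limsup

theorem norm_sub_voronoiQuantization {E Ω : Type*} [NormedAddCommGroup E] [MeasurableSpace E]
    {α : Finset E} {C : E → Set E} (hC : IsVoronoiPartition α C) (X : Ω → E) (ω : Ω) :
    ‖X ω - voronoiQuantization α C X ω‖ = infDist (X ω) (α : Set E) := by
  obtain ⟨a, ha, hx⟩ := hC.covers (X ω)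
  have hq : voronoiQuantization α C X ω = a := by
    rw [voronoiQuantization, Finset.sum_eq_single_of_mem a ha fun a' ha' hne =>
      Set.indicator_of_notMem (s := X ⁻¹' C a')
        (fun hx' => Set.disjoint_left.1 (hC.disjoint a' ha' a ha hne) hx' hx) _]
    exact Set.indicator_of_mem (s := X ⁻¹' C a) hx _
  rw [hq, ← dist_eq_norm]
  refine le_antisymm ((le_infDist ⟨a, ha⟩).2 fun a' ha' => ?_) (infDist_le_dist_of_mem ha)
  simpa only [dist_eq_norm] using hC.nearest a ha _ hx a' ha'

section Dilation

variable {E : Type*} [NormedAddCommGroup E] [NormedSpace ℝ E]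

open scoped Pointwise in
theorem infDist_dilate {θ : ℝ} (hθ : θ ≠ 0) (μ x : E) (α : Finset E) :
    infDist x (dilate θ μ α : Set E) = |θ| * infDist (θ⁻¹ • (x - μ) + μ) (α : Set E) := by
  have himage : (dilate θ μ α : Set E) = (μ + ·) '' (θ • ((· - μ) '' (α : Set E))) := by
    classical
    simp [dilate, Set.image_image, ← Set.image_smul]
  have hx : x = μ + θ • (θ⁻¹ • (x - μ) + μ - μ) := by simp [smul_inv_smul₀ hθ]
  conv_lhs => rw [himage, hx]
  rw [infDist_image (isometry_add_left μ), infDist_smul₀ hθ, Real.norm_eq_abs]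
  exact congrArg (|θ| * ·) (infDist_image (IsometryEquiv.subRight μ).isometry)

variable [MeasurableSpace E] [BorelSpace E]

theorem measurable_inv_smul_sub_add (θ : ℝ) (μ : E) :
    Measurable fun x : E => θ⁻¹ • (x - μ) + μ :=
  ((measurable_id.sub_const μ).const_smul θ⁻¹).add_const μ

theorem lintegral_norm_sub_voronoiQuantization {Ω : Type*} [MeasurableSpace Ω]
    {Pr : Measure Ω} {X : Ω → E} {P : Measure E} (hX : HasLaw X P Pr) {θ s : ℝ} (hθ : θ ≠ 0)
    (hs : 0 ≤ s) (μ : E) {α : Finset E} {V : E → Set E}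
    (hV : IsVoronoiPartition (dilate θ μ α) V) :
    ∫⁻ ω, ‖X ω - voronoiQuantization (dilate θ μ α) V X ω‖ₑ ^ s ∂Pr =
      ENNReal.ofReal (|θ| ^ s) * ∫⁻ y, ENNReal.ofReal (infDist y (α : Set E)) ^ s
        ∂(dilatedLaw θ μ P) := by
  have hT := measurable_inv_smul_sub_add θ μ
  have hg : Measurable fun y : E => ENNReal.ofReal (infDist y (α : Set E)) ^ s :=
    (continuous_infDist_pt _).measurable.ennreal_ofReal.pow_const s
  rw [dilatedLaw, lintegral_map hg hT, ← hX.lintegral_comp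
      (f := fun x => ENNReal.ofReal (infDist (θ⁻¹ • (x - μ) + μ) (α : Set E)) ^ s)
      (hg.comp hT).aemeasurable,
    ← lintegral_const_mul' _ _ ENNReal.ofReal_ne_top]
  refine lintegral_congr fun ω => ?_
  rw [← ofReal_norm, norm_sub_voronoiQuantization hV, infDist_dilate hθ,
    ENNReal.ofReal_mul (abs_nonneg θ), ENNReal.mul_rpow_of_nonneg _ _ hs,
    ENNReal.ofReal_rpow_of_nonneg (abs_nonneg θ) hs]

theorem limsup_lintegral_norm_sub_voronoiQuantization {Ω : Type*} [MeasurableSpace Ω]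
    {Pr : Measure Ω} {X : Ω → E} {P : Measure E} (hX : HasLaw X P Pr) {θ s : ℝ} (hθ : θ ≠ 0)
    (hs : 0 ≤ s) (μ : E) {α : ℕ → Finset E} {V : ℕ → E → Set E}
    (hV : ∀ᶠ n in atTop, IsVoronoiPartition (dilate θ μ (α n)) (V n)) (c : ℕ → ℝ≥0∞) :
    limsup (fun n => c n *
        ∫⁻ ω, ‖X ω - voronoiQuantization (dilate θ μ (α n)) (V n) X ω‖ₑ ^ s ∂Pr) atTop =
      ENNReal.ofReal (|θ| ^ s) * limsup (fun n => c n *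
        ∫⁻ y, ENNReal.ofReal (infDist y (α n : Set E)) ^ s ∂(dilatedLaw θ μ P)) atTop := by
  rw [← ENNReal.limsup_const_mul_of_ne_top ENNReal.ofReal_ne_top]
  refine limsup_congr ?_
  filter_upwards [hV] with n hn
  rw [lintegral_norm_sub_voronoiQuantization hX hθ hs μ hn, mul_left_comm]

theorem lintegral_dilatedLaw_withDensity [FiniteDimensional ℝ E] (vol : Measure E)
    [vol.IsAddHaarMeasure] {f g : E → ℝ≥0∞} (hf : Measurable f) (hg : Measurable g) {θ : ℝ}
    (hθ : θ ≠ 0) (μ : E) :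
    ∫⁻ x, g x ∂(dilatedLaw θ μ (vol.withDensity f)) =
      ENNReal.ofReal (|θ| ^ Module.finrank ℝ E) * ∫⁻ x, f (μ + θ • (x - μ)) * g x ∂vol := by
  have hT := measurable_inv_smul_sub_add θ μ
  have hS : Measurable fun x : E => μ + θ • (x - μ) :=
    ((measurable_id.sub_const μ).const_smul θ).const_add μ
  set h : E → ℝ≥0∞ := fun y => f (μ + θ • (y - μ)) * g y with hh
  have hhm : Measurable h := (hf.comp hS).mul hg
  rw [dilatedLaw, lintegral_map hg hT,
    lintegral_withDensity_eq_lintegral_mul _ hf (g := fun x => g (θ⁻¹ • (x - μ) + μ)) (hg.comp hT)]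
  calc _ = ∫⁻ x, h (θ⁻¹ • (x - μ) + μ) ∂vol :=
        lintegral_congr fun x => by simp [hh, smul_inv_smul₀ hθ]
    _ = ∫⁻ x, h (θ⁻¹ • x + μ) ∂vol :=
        lintegral_sub_right_eq_self (fun x => h (θ⁻¹ • x + μ)) μ
    _ = ∫⁻ y, h (y + μ) ∂(vol.map fun x => θ⁻¹ • x) :=
        (lintegral_map (hhm.comp (measurable_id.add_const μ)) (measurable_const_smul θ⁻¹)).symm
    _ = ENNReal.ofReal (|θ| ^ Module.finrank ℝ E) * ∫⁻ y, h (y + μ) ∂vol := by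
        rw [Measure.map_addHaar_smul vol (inv_ne_zero hθ), lintegral_smul_measure, inv_pow,
          inv_inv, abs_pow, smul_eq_mul]
    _ = _ := by rw [lintegral_add_right_eq_self]

theorem ofReal_mul_lintegral_comp_dilation_mul [FiniteDimensional ℝ E] (vol : Measure E)
    [vol.IsAddHaarMeasure] {f g : E → ℝ≥0∞} (hf : Measurable f) (hg : Measurable g) {θ : ℝ}
    (hθ : θ ≠ 0) (μ : E) (s : ℝ) {C : ℝ} (hC : 0 ≤ C) :
    ENNReal.ofReal (|θ| ^ (s + Module.finrank ℝ E) * C) *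
        ∫⁻ x, f (μ + θ • (x - μ)) * g x ∂vol =
      ENNReal.ofReal (|θ| ^ s) *
        (ENNReal.ofReal C * ∫⁻ x, g x ∂(dilatedLaw θ μ (vol.withDensity f))) := by
  rw [lintegral_dilatedLaw_withDensity vol hf hg hθ, Real.rpow_add_natCast (abs_ne_zero.2 hθ),
    ENNReal.ofReal_mul' hC, ENNReal.ofReal_mul (by positivity)]
  ring

end Dilation

end Quantization

open Quantization in
theorem theorem3_general
    {E : Type*} [NormedAddCommGroup E] [NormedSpace ℝ E] [FiniteDimensional ℝ E] [Nontrivial E]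
    [MeasurableSpace E] [BorelSpace E]
    (vol : Measure E) [vol.IsAddHaarMeasure]
    (d : ℕ) (hd : Module.finrank ℝ E = d)
    {Ω : Type*} [MeasurableSpace Ω] (Pr : Measure Ω) [IsFiniteMeasure Pr]
    (X : Ω → E) (P : Measure E) (hX : HasLaw X P Pr)
    (f : E → ℝ≥0) (hf : Measurable f) (hP : P = vol.withDensity (fun x => (f x : ℝ≥0∞)))
    (r s : ℝ) (hr : 0 < r) (hs : 0 < s)
    (hmoment : ∃ η : ℝ, 0 < η ∧ ∫⁻ ω, ‖X ω‖ₑ ^ (r + η) ∂Pr < ∞)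
    (b : ℝ) (hb : 0 < b) (hb' : b < 1 / 2) :
    ∃ C : ℝ, 0 < C ∧
      ∀ (θ : ℝ) (μ : E) (α : ℕ → Finset E), θ ≠ 0 → dilatedLaw θ μ P ≪ P →
        IsOptimalSequence P r α →
        ∫⁻ x, maximalFunction vol P α b x ^ (s / (d + r)) ∂(dilatedLaw θ μ P) < ∞ →
        ∀ V : ℕ → E → Set E,
          (∀ n, 1 ≤ n → IsVoronoiPartition (dilate θ μ (α n)) (V n)) →
          limsup (fun n : ℕ => (n : ℝ≥0∞) ^ (s / d) *
              ∫⁻ ω, ‖X ω - voronoiQuantization (dilate θ μ (α n)) (V n) X ω‖ₑ ^ s ∂Pr) atTop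
            ≤ ENNReal.ofReal (|θ| ^ (s + d) * C) *
                ∫⁻ x, (f (μ + θ • (x - μ)) : ℝ≥0∞) * (f x : ℝ≥0∞) ^ (-(s / (d + r))) ∂vol ∧
          ENNReal.ofReal (|θ| ^ (s + d) * C) *
              ∫⁻ x, (f (μ + θ • (x - μ)) : ℝ≥0∞) * (f x : ℝ≥0∞) ^ (-(s / (d + r))) ∂vol < ∞ := by
  subst hd hP
  obtain ⟨η, hη, hmom⟩ := hmoment
  have : IsFiniteMeasure (vol.withDensity fun x => (f x : ℝ≥0∞)) := hX.map_eq ▸ inferInstance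
  have hfm : Measurable fun x => (f x : ℝ≥0∞) := hf.coe_nnreal_ennreal
  have hσ : 1 < (r + η) / r := by rw [one_lt_div hr]; linarith
  have hweight := (lintegral_weight_rpow_lt_top _ (by positivity) hr.ne'
    ((hX.lintegral_comp (f := fun x => ‖x‖ₑ ^ (r + η)) (by fun_prop)).symm.trans_lt hmom)).ne
  obtain ⟨K, hK, hbound⟩ := exists_rpow_infDist_le_mul_ballRatio vol hr hσ hweight hb hb'
  have hdr : 0 < Module.finrank ℝ E + r := by positivity
  have hp : 0 ≤ s / (Module.finrank ℝ E + r) := by positivity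
  obtain ⟨C, hKC, -⟩ := ENNReal.lt_iff_exists_nnreal_btwn.1
    (ENNReal.rpow_ne_top_of_nonneg hp hK).lt_top
  rw [← ENNReal.ofReal_coe_nnreal] at hKC
  refine ⟨C, ENNReal.ofReal_pos.1 hKC.bot_lt, fun θ μ α hθ hac hα hψ V hV => ?_⟩
  have hlim := hac.ae_le (ae_tendsto_ballRatio_infDist_withDensity vol hfm hr.le hb
    ((eventually_ge_atTop 1).mono fun n hn => (hα n hn).1) (hα.tendsto_distortion hr hσ hweight))
  rw [ofReal_mul_lintegral_comp_dilation_mul vol hfm (hfm.pow_const _) hθ μ s C.coe_nonneg]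
  constructor
  · rw [limsup_lintegral_norm_sub_voronoiQuantization hX hθ hs.le μ
      ((eventually_ge_atTop 1).mono hV)]
    gcongr
    exact (limsup_lintegral_infDist_rpow_le (Nat.cast_pos.2 Module.finrank_pos) hdr hs.le hK
      (hbound α hα) hlim hψ.ne).trans (by gcongr)
  · have hint := (lintegral_rpow_neg_le_lintegral_maximalFunction_rpow hp hlim).trans_lt hψ
    finiteness

theorem theorem3
    {E : Type*} [NormedAddCommGroup E] [NormedSpace ℝ E] [FiniteDimensional ℝ E] [Nontrivial E]
    [MeasurableSpace E] [BorelSpace E]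
    (vol : Measure E) [vol.IsAddHaarMeasure]
    (d : ℕ) (hd : Module.finrank ℝ E = d)
    {Ω : Type*} [MeasurableSpace Ω] (Pr : Measure Ω) [IsProbabilityMeasure Pr]
    (X : Ω → E) (P : Measure E) (hX : HasLaw X P Pr)
    (f : E → ℝ≥0) (hf : Measurable f) (hP : P = vol.withDensity (fun x => (f x : ℝ≥0∞)))
    (r s : ℝ) (hr : 0 < r) (hrs : r < s)
    (hmoment : ∃ η : ℝ, 0 < η ∧ ∫⁻ ω, ‖X ω‖ₑ ^ (r + η) ∂Pr < ∞)
    (b : ℝ) (hb : 0 < b) (hb' : b < 1 / 2) :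
    ∃ C : ℝ, 0 < C ∧
      ∀ (θ : ℝ) (μ : E) (α : ℕ → Finset E), 0 < θ →
        (Quantization.dilatedLaw θ μ P).AbsolutelyContinuous P →
        Quantization.IsOptimalSequence P r α →
        ∫⁻ x, Quantization.maximalFunction vol P α b x ^ (s / (d + r))
          ∂(Quantization.dilatedLaw θ μ P) < ∞ →
        ∀ V : ℕ → E → Set E,
          (∀ n, 1 ≤ n →
            Quantization.IsVoronoiPartition (Quantization.dilate θ μ (α n)) (V n)) →
          limsup (fun n : ℕ => (n : ℝ≥0∞) ^ (s / d) *
              ∫⁻ ω, ‖X ω - Quantization.voronoiQuantization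
                (Quantization.dilate θ μ (α n)) (V n) X ω‖ₑ ^ s ∂Pr) atTop
            ≤ ENNReal.ofReal (θ ^ (s + d) * C) *
                ∫⁻ x, (f (μ + θ • (x - μ)) : ℝ≥0∞) * (f x : ℝ≥0∞) ^ (-(s / (d + r))) ∂vol ∧
          ENNReal.ofReal (θ ^ (s + d) * C) *
              ∫⁻ x, (f (μ + θ • (x - μ)) : ℝ≥0∞) * (f x : ℝ≥0∞) ^ (-(s / (d + r))) ∂vol < ∞ := by
  obtain ⟨C, hC, h⟩ := theorem3_general vol d hd Pr X P hX f hf hP r s hr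
    (hr.trans hrs) hmoment b hb hb'
  exact ⟨C, hC, fun θ μ α hθ => by simpa only [abs_of_pos hθ] using h θ μ α hθ.ne'⟩
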